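/- Theorem C (local improvement). Let $n\ge 2$ be an integer and let $p,q$ be real numbers with $1\le q<p$. For a bounded domain (open connected set) $\Omega\subset\mathbb{R}^n$ containing the origin and a real-valued $u\in C_c^\infty(\Omega\setminus\{0\})$, extended by zero to $\mathbb{R}^n$, put $$I[u]:=\int_\Omega|\nabla u|^p\,dx-\left|\frac{n-p}{p}\right|^p\int_\Omega\frac{|u|^p}{|x|^p}\,dx,\qquad X(t):=(1-\log t)^{-1}\quad(0<t\le 1).$$ (i) Suppose $p>n$. There exist constants $\Theta=\Theta(n,p,q)\ge 0$ and $C=C(n,p,q)>0$ such that for every bounded domain $\Omega\subset\mathbb{R}^n$ containing the origin and every $u\in C_c^\infty(\Omega\setminus\{0\})$ one has $I[u]\ge 0$ and, for every open ball $B_r\subset\mathbb{R}^n$ (with arbitrary centre) of radius $r\in(0,\operatorname{diam}\Omega)$ and every $D\ge e^{\Theta}\operatorname{diam}\Omega$, $$r^{n/p}\,X^{1/p}(r/D)\left(\frac1{|B_r|}\int_{B_r}\frac{|u|^q}{|x|^q}\,dx\right)^{1/q}\le C\,I[u]^{1/p}.$$ (ii) Suppose only $p\ne n$. There exist constants $\Theta=\Theta(n,p,q)\ge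 0$ and $C=C(n,p,q)>0$ such that for all $\Omega$, $u$, $r$, $D$ as in (i) one has $I[u]\ge 0$, and the same inequality holds for every open ball $B_r$ of radius $r$ whose closure contains the origin. -/

import Mathlib

open MeasureTheory
open scoped ContDiff

noncomputable section

/-- `ℝⁿ` with its Euclidean norm. -/
abbrev Euc (n : ℕ) : Type := EuclideanSpace ℝ (Fin n)

/-- A bounded domain (bounded, open, connected set) of `ℝⁿ` containing the origin. -/
structure IsBoundedDomainAtZero {n : ℕ} (Ω : Set (Euc n)) : Prop where
  isOpen : IsOpen Ω
  isConnected : IsConnected Ω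
  isBounded : Bornology.IsBounded Ω
  zero_mem : (0 : Euc n) ∈ Ω

/-- `u ∈ C_c^∞(U)`, the function `u` being extended by zero to the whole of `ℝⁿ`. -/
structure IsTestFunctionOn {n : ℕ} (U : Set (Euc n)) (u : Euc n → ℝ) : Prop where
  contDiff : ContDiff ℝ ∞ u
  hasCompactSupport : HasCompactSupport u
  tsupport_subset : tsupport u ⊆ U

/-- The logarithmic weight `X(t) = (1 - log t)⁻¹`, used for `t ∈ (0, 1]`. -/
def logWeight (t : ℝ) : ℝ := (1 - Real.log t)⁻¹

/-- The Hardy difference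
`I[u] = ∫_Ω |∇u|^p dx - |(n - p)/p|^p ∫_Ω |u|^p / |x|^p dx`. -/
def hardyDifference {n : ℕ} (p : ℝ) (Ω : Set (Euc n)) (u : Euc n → ℝ) : ℝ :=
  (∫ x in Ω, ‖gradient u x‖ ^ p) -
    |((n : ℝ) - p) / p| ^ p * ∫ x in Ω, |u x| ^ p / ‖x‖ ^ p

/-- The left-hand side
`r^{n/p} X^{1/p}(r/D) (|B_r|⁻¹ ∫_{B_r} |u|^q / |x|^q dx)^{1/q}` on the open ball of centre `c` and
radius `r`. -/
def localHardyMean {n : ℕ} (p q D : ℝ) (u : Euc n → ℝ) (c : Euc n) (r : ℝ) : ℝ :=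
  r ^ ((n : ℝ) / p) * logWeight (r / D) ^ (1 / p) *
    ((volume.real (Metric.ball c r))⁻¹ *
      ∫ x in Metric.ball c r, |u x| ^ q / ‖x‖ ^ q) ^ (1 / q)

end

/-!
The theorem is a statement about a perturbed ground state of the Hardy inequality, followed by
Hölder's inequality.

Write `s = (p - n) / p`, so that `|x| ^ s` is the virtual ground state. Young's inequality, in the
form of the tangent of `|·| ^ p` at a point proportional to `s u / |x|`, and the divergence
theorem for the field `(1 + θ (log |x|)) |x| ^ (-p) |u| ^ p x` give, for every small radial
perturbation `θ`, the Hardy inequality with the extra density `-s |s| ^ (p - 2) θ' - C θ ^ 2`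
against `|u| ^ p / |x| ^ p` (`integral_hardyRemainder_le`). Taking `θ = 0` gives `I[u] ≥ 0`.
Taking `θ` proportional to `-sign s * σ (t) / (L - t)`, where `t = log |x|`, `σ` is a logistic
function centred at an arbitrary `t₀` and `L = log (diam Ω) + 2`, the derivative of `1 / (L - t)`
absorbs the quadratic term, and the derivative of `σ` leaves a positive weight
`σ (1 - σ) / (L - t)` up to constants, with a constant independent of `t₀`
(`exists_mul_integral_logisticWeight_le`).

For a ball of radius `r` close to the origin the weight is centred at scale `r`, for a distant
ball at the scale of its distance to the origin. In both cases it dominates a constant times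
`X(r / D) min(1, |x| / r) ^ ((p - q) / q)` on the ball (`exists_min_rpow_le_logisticWeight`). Hölder's
inequality with exponents `p / q` and `p / (p - q)` (`setIntegral_ball_rpow_le`) passes from this
weighted `L ^ p` bound to the `L ^ q` mean; the dual integrand `max(1, r / |x|)` is integrable
because `n ≥ 2`, with integral at most `3 |B_r|`. Neither the position of the ball nor the sign of
`p - n` matters, and `Θ = 0` is admissible.
-/

/-! ### Elementary inequalities for real powers -/

lemma one_add_rpow_le_quadratic {β θ : ℝ} (hβ : 1 ≤ β) (hθ : |θ| * (4 * β) ≤ 1) :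
    (1 + θ) ^ β ≤ 1 + β * θ + 8 * β ^ 2 * θ ^ 2 := by
  have habs : |θ| ≤ 1 / 4 := by nlinarith [abs_nonneg θ]
  obtain ⟨h1, h2⟩ := abs_le.1 habs
  have hpos : 0 < 1 + θ := by linarith
  -- Bernoulli's inequality is applied to `(1 + θ)⁻¹ = 1 - y`.
  set y := θ / (1 + θ) with hy
  have hyθ : y * (1 + θ) = θ := by rw [hy]; field_simp
  have hyabs : |y| ≤ 4 / 3 * |θ| := by
    have h : |y| * (1 + θ) = |θ| := by
      conv_rhs => rw [← hyθ, abs_mul, abs_of_pos hpos]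
    nlinarith [abs_nonneg y]
  have hβy : |β * y| ≤ 1 / 3 := by
    rw [abs_mul, abs_of_pos (by linarith : (0 : ℝ) < β)]
    nlinarith
  obtain ⟨h3, h4⟩ := abs_le.1 hβy
  have hinv : 1 + -y = (1 + θ)⁻¹ := by
    rw [hy]; field_simp; ring
  have hbern : 1 + β * -y ≤ (1 + -y) ^ β := by
    refine one_add_mul_self_le_rpow_one_add ?_ hβ
    have : 0 < 1 + -y := by rw [hinv]; positivity
    linarith
  rw [hinv, Real.inv_rpow hpos.le] at hbern
  have hA : 0 < (1 + θ) ^ β := Real.rpow_pos_of_pos hpos β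
  have hprod : (1 + β * -y) * (1 + θ) ^ β ≤ 1 := by
    calc (1 + β * -y) * (1 + θ) ^ β ≤ ((1 + θ) ^ β)⁻¹ * (1 + θ) ^ β := by gcongr
      _ = 1 := inv_mul_cancel₀ hA.ne'
  have hgeom : (1 + θ) ^ β ≤ 1 + β * y + 3 / 2 * (β * y) ^ 2 := by
    have h5 : 1 ≤ (1 + β * -y) * (1 + β * y + 3 / 2 * (β * y) ^ 2) := by
      nlinarith [mul_nonneg (sq_nonneg (β * y)) (by linarith : 0 ≤ 1 / 3 - β * y)]
    have h6 : 0 < 1 + β * -y := by linarith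
    nlinarith
  have hyle : y ≤ θ := by
    have : θ - y = y * θ := by linarith
    have h7 : 0 ≤ y * θ := by
      have : y * θ = y ^ 2 * (1 + θ) := by rw [sq, mul_assoc, hyθ]
      rw [this]; positivity
    linarith
  have hysq : y ^ 2 ≤ 16 / 9 * θ ^ 2 := by
    have := mul_self_le_mul_self (abs_nonneg y) hyabs
    nlinarith [abs_mul_abs_self y, abs_mul_abs_self θ]
  calc (1 + θ) ^ β ≤ 1 + β * y + 3 / 2 * (β * y) ^ 2 := hgeom
    _ = 1 + β * y + 3 / 2 * β ^ 2 * y ^ 2 := by ring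
    _ ≤ 1 + β * θ + 3 / 2 * β ^ 2 * (16 / 9 * θ ^ 2) := by gcongr
    _ ≤ 1 + β * θ + 8 * β ^ 2 * θ ^ 2 := by nlinarith [mul_nonneg (sq_nonneg β) (sq_nonneg θ)]

lemma abs_signed_rpow {p : ℝ} (hp : 1 < p) (b : ℝ) :
    |(|b| ^ (p - 2) * b)| = |b| ^ (p - 1) := by
  rcases eq_or_ne b 0 with rfl | hb
  · simp [Real.zero_rpow (by linarith : p - 1 ≠ 0)]
  · have hb' : 0 < |b| := abs_pos.2 hb
    rw [abs_mul, abs_of_nonneg (Real.rpow_nonneg hb'.le _), ← Real.rpow_add_one hb'.ne']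
    congr 1; ring

lemma abs_signed_rpow_rpow_conj {p : ℝ} (hp : 1 < p) (b : ℝ) :
    |(|b| ^ (p - 2) * b)| ^ (p / (p - 1)) = |b| ^ p := by
  rw [abs_signed_rpow hp, ← Real.rpow_mul (abs_nonneg b)]
  congr 1
  have : p - 1 ≠ 0 := by linarith
  field_simp

/-- Convexity of `|·| ^ p`: the tangent at the point `s (1 + θ) ^ (1 / (p - 1)) b`, in the form of
Young's inequality. -/
lemma young_tangent_le {p : ℝ} (hp : 1 < p) (s a b : ℝ) {θ : ℝ} (hθ : 0 ≤ 1 + θ) :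
    (|s| ^ (p - 2) * s) * (1 + θ) * (p * |b| ^ (p - 2) * b * a)
      - (p - 1) * |s| ^ p * (1 + θ) ^ (p / (p - 1)) * |b| ^ p ≤ |a| ^ p := by
  have hp1 : 0 < p - 1 := by linarith
  have hconj : p.HolderConjugate (p / (p - 1)) := Real.HolderConjugate.conjExponent hp
  have h := Real.young_inequality a ((|s| ^ (p - 2) * s) * (1 + θ) * (|b| ^ (p - 2) * b)) hconj
  rw [abs_mul, abs_mul, Real.mul_rpow (by positivity) (by positivity),
    Real.mul_rpow (by positivity) (by positivity), abs_signed_rpow_rpow_conj hp,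
    abs_signed_rpow_rpow_conj hp, abs_of_nonneg hθ] at h
  have h2 := mul_le_mul_of_nonneg_left h (by linarith : 0 ≤ p)
  have e : p * (|a| ^ p / p + |s| ^ p * (1 + θ) ^ (p / (p - 1)) * |b| ^ p / (p / (p - 1)))
      = |a| ^ p + (p - 1) * |s| ^ p * (1 + θ) ^ (p / (p - 1)) * |b| ^ p := by
    field_simp
  rw [e] at h2
  linarith

/-! ### Euler's identity -/

/-- Euler's identity `∫ x · ∇G = -n ∫ G`, that is, the divergence theorem for the field `G(x) x`. -/
lemma integral_fderiv_apply_self {n : ℕ} {G : Euc n → ℝ} (hG : ContDiff ℝ 1 G)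
    (hc : HasCompactSupport G) :
    ∫ x, fderiv ℝ G x x = -(n * ∫ x, G x) := by
  have hcont : Continuous (fderiv ℝ G) := hG.continuous_fderiv one_ne_zero
  have hcoord : ∀ i : Fin n, Continuous fun x : Euc n => x i := fun i => by fun_prop
  have hderiv : ∀ (i : Fin n) (x : Euc n), HasFDerivAt (fun y : Euc n => y i)
      (EuclideanSpace.proj (𝕜 := ℝ) i) x := fun i x =>
    (EuclideanSpace.proj (𝕜 := ℝ) i : Euc n →L[ℝ] ℝ).hasFDerivAt
  have hterm : ∀ i : Fin n,
      ∫ x : Euc n, x i * fderiv ℝ G x (EuclideanSpace.single i 1) = -∫ x, G x := by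
    intro i
    have h := integral_mul_fderiv_eq_neg_fderiv_mul_of_integrable (μ := (volume : Measure (Euc n)))
      (f := fun x : Euc n => x i) (g := G) (v := EuclideanSpace.single i (1 : ℝ)) ?_ ?_ ?_ ?_ ?_
    · rw [h]
      congr 2
      ext x
      simp [(hderiv i x).fderiv]
    · simp only [(hderiv i _).fderiv]
      simpa using hG.continuous.integrable_of_hasCompactSupport hc
    · refine Continuous.integrable_of_hasCompactSupport (by fun_prop) ?_
      exact ((hc.fderiv_apply ℝ _).mul_left)
    · exact Continuous.integrable_of_hasCompactSupport ((hcoord i).mul hG.continuous) hc.mul_left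
    · exact fun x _ => (hderiv i x).differentiableAt
    · exact fun x _ => (hG.differentiable one_ne_zero) x
  have hint : ∀ i : Fin n,
      Integrable fun x : Euc n => x i * fderiv ℝ G x (EuclideanSpace.single i 1) := fun i =>
    Continuous.integrable_of_hasCompactSupport (by fun_prop) ((hc.fderiv_apply ℝ _).mul_left)
  have hexp : ∀ x : Euc n, fderiv ℝ G x x
      = ∑ i, x i * fderiv ℝ G x (EuclideanSpace.single i 1) := by
    intro x
    have h := congrArg (fderiv ℝ G x) ((EuclideanSpace.basisFun (Fin n) ℝ).sum_repr x)
    rw [← h, map_sum]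
    simp
  simp_rw [hexp]
  rw [integral_finsetSum _ fun i _ => hint i]
  simp [hterm]

/-! ### Hardy's inequality with a radial perturbation of the ground state -/

lemma continuous_mul_abs_rpow {n : ℕ} {u w : Euc n → ℝ} {p : ℝ} (hp : 0 < p) (hu : Continuous u)
    (hw : ∀ x ∈ tsupport u, ContinuousAt w x) : Continuous fun x => w x * |u x| ^ p := by
  refine continuous_of_tsupport fun x hx => ?_
  have hsub : tsupport (fun x => w x * |u x| ^ p) ⊆ tsupport u := by
    refine closure_mono fun y hy => ?_
    contrapose! hy
    simp only [Function.mem_support, ne_eq, not_not] at hy ⊢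
    simp [hy, Real.zero_rpow hp.ne']
  exact (hw x (hsub hx)).mul ((hu.abs.rpow_const fun _ => Or.inr hp.le).continuousAt)

lemma hasCompactSupport_mul_abs_rpow {n : ℕ} {u : Euc n → ℝ} (w : Euc n → ℝ) {p : ℝ} (hp : 0 < p)
    (hc : HasCompactSupport u) : HasCompactSupport fun x => w x * |u x| ^ p := by
  have h : HasCompactSupport fun x => |u x| ^ p :=
    hc.comp_left (g := fun t : ℝ => |t| ^ p) (by simp [Real.zero_rpow hp.ne'])
  exact h.mul_left

lemma integrable_mul_abs_rpow {n : ℕ} {u w : Euc n → ℝ} {p : ℝ} (hp : 0 < p) (hu : Continuous u)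
    (hc : HasCompactSupport u) (hw : ∀ x ∈ tsupport u, ContinuousAt w x) :
    Integrable fun x => w x * |u x| ^ p :=
  (continuous_mul_abs_rpow hp hu hw).integrable_of_hasCompactSupport
    (hasCompactSupport_mul_abs_rpow w hp hc)

lemma norm_gradient {n : ℕ} (u : Euc n → ℝ) (x : Euc n) : ‖gradient u x‖ = ‖fderiv ℝ u x‖ := by
  simp [gradient]

lemma integrable_norm_gradient_rpow {n : ℕ} {u : Euc n → ℝ} {p : ℝ} (hp : 0 < p)
    (hu : ContDiff ℝ 1 u) (hc : HasCompactSupport u) :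
    Integrable fun x => ‖gradient u x‖ ^ p := by
  simp_rw [norm_gradient]
  refine Continuous.integrable_of_hasCompactSupport
    ((hu.continuous_fderiv one_ne_zero).norm.rpow_const fun _ => Or.inr hp.le) ?_
  exact (hc.fderiv ℝ).comp_left (g := fun L : Euc n →L[ℝ] ℝ => ‖L‖ ^ p)
    (by simp [Real.zero_rpow hp.ne'])

/-- The power `(p - n) / p` of the virtual ground state `|x| ^ ((p - n) / p)` of the Hardy
inequality. -/
noncomputable def hardyExponent (n : ℕ) (p : ℝ) : ℝ := (p - n) / p

/-- The density against `|u| ^ p / |x| ^ p`, as a function of `t = log |x|`, which the perturbation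
`θ` adds to the Hardy inequality. -/
noncomputable def hardyRemainder (n : ℕ) (p : ℝ) (θ : ℝ → ℝ) (t : ℝ) : ℝ :=
  -(|hardyExponent n p| ^ (p - 2) * hardyExponent n p * deriv θ t) -
    8 * (p - 1) * (p / (p - 1)) ^ 2 * |hardyExponent n p| ^ p * θ t ^ 2

lemma hardyDifference_eq_integral {n : ℕ} {p : ℝ} (hp : 1 < p) {Ω : Set (Euc n)} {u : Euc n → ℝ}
    (hu : IsTestFunctionOn (Ω \ {0}) u) :
    Integrable (fun x => ‖x‖ ^ (-p) * |u x| ^ p) ∧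
    hardyDifference p Ω u = ∫ x, (‖gradient u x‖ ^ p -
      |hardyExponent n p| ^ p * (‖x‖ ^ (-p) * |u x| ^ p)) := by
  have hp0 : 0 < p := by linarith
  have hu1 : ContDiff ℝ 1 u := hu.contDiff.of_le (by norm_cast)
  have hout : ∀ x ∉ Ω, x ∉ tsupport u := fun x hx h => hx (hu.tsupport_subset h).1
  have hI : Integrable fun x => ‖x‖ ^ (-p) * |u x| ^ p := by
    refine integrable_mul_abs_rpow hp0 hu1.continuous hu.hasCompactSupport fun x hx => ?_
    have hx0 : x ≠ 0 := (hu.tsupport_subset hx).2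
    exact continuous_norm.continuousAt.rpow_const (Or.inl (norm_ne_zero_iff.2 hx0))
  refine ⟨hI, ?_⟩
  have hdiv : ∀ x, |u x| ^ p / ‖x‖ ^ p = ‖x‖ ^ (-p) * |u x| ^ p := fun x => by
    rw [Real.rpow_neg (norm_nonneg _), div_eq_mul_inv, mul_comm]
  unfold hardyDifference
  simp_rw [hdiv]
  rw [setIntegral_eq_integral_of_forall_compl_eq_zero,
    setIntegral_eq_integral_of_forall_compl_eq_zero,
    integral_sub (integrable_norm_gradient_rpow hp0 hu1 hu.hasCompactSupport) (hI.const_mul _),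
    integral_const_mul]
  · congr 3
    rw [hardyExponent, abs_div, abs_div, abs_sub_comm]
  · intro x hx
    rw [image_eq_zero_of_notMem_tsupport (hout x hx)]
    simp [Real.zero_rpow hp0.ne']
  · intro x hx
    have h0 : fderiv ℝ u x = 0 := by
      rw [(notMem_tsupport_iff_eventuallyEq.1 (hout x hx)).fderiv_eq]; simp
    rw [norm_gradient, h0]
    simp [Real.zero_rpow hp0.ne']

/-- Hardy's inequality with remainder. Young's inequality is integrated after multiplying the
calibrating field `|s| ^ (p - 2) s |x| ^ (-p) x`, `s = hardyExponent n p`, by `1 + θ (log |x|)`. -/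
lemma integral_hardyRemainder_le {n : ℕ} {p : ℝ} (hp : 1 < p) {Ω : Set (Euc n)} {u : Euc n → ℝ}
    (hu : IsTestFunctionOn (Ω \ {0}) u) {T : ℝ} (hT : ∀ x ∈ Ω, x ≠ 0 → Real.log ‖x‖ < T) {θ : ℝ → ℝ}
    (hθ : ContDiffOn ℝ 1 θ (Set.Iio T)) (hθs : ∀ t < T, |θ t| * (4 * (p / (p - 1))) ≤ 1) :
    Integrable (fun x => hardyRemainder n p θ (Real.log ‖x‖) * ‖x‖ ^ (-p) * |u x| ^ p) ∧
    ∫ x, hardyRemainder n p θ (Real.log ‖x‖) * ‖x‖ ^ (-p) * |u x| ^ p ≤ hardyDifference p Ω u := by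
  have hp0 : 0 < p := by linarith
  have hp1 : 0 < p - 1 := by linarith
  have hu1 : ContDiff ℝ 1 u := hu.contDiff.of_le (by norm_cast)
  have hne : ∀ x ∈ tsupport u, x ≠ 0 := fun x hx => (hu.tsupport_subset hx).2
  have hlt : ∀ x ∈ tsupport u, Real.log ‖x‖ < T := fun x hx =>
    hT x (hu.tsupport_subset hx).1 (hne x hx)
  have hlogc : ∀ x : Euc n, x ≠ 0 → ContDiffAt ℝ 1 (fun y : Euc n => Real.log ‖y‖) x := fun x hx =>
    (contDiffAt_norm ℝ hx).log (norm_ne_zero_iff.2 hx)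
  have hθat : ∀ t < T, ContDiffAt ℝ 1 θ t := fun t ht => hθ.contDiffAt (Iio_mem_nhds ht)
  have hθ' : ContinuousOn (deriv θ) (Set.Iio T) :=
    hθ.continuousOn_deriv_of_isOpen isOpen_Iio le_rfl
  obtain ⟨hI, hdiff⟩ := hardyDifference_eq_integral hp hu
  set s := hardyExponent n p with hs
  set κ := |s| ^ (p - 2) * s with hκ
  have hRint : Integrable
      fun x => hardyRemainder n p θ (Real.log ‖x‖) * ‖x‖ ^ (-p) * |u x| ^ p := by
    refine integrable_mul_abs_rpow hp0 hu1.continuous hu.hasCompactSupport fun x hx => ?_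
    have hx0 := hne x hx
    have hR : ContinuousAt (hardyRemainder n p θ) (Real.log ‖x‖) := by
      have h1 := (hθat _ (hlt x hx)).continuousAt
      have h2 := hθ'.continuousAt (Iio_mem_nhds (hlt x hx))
      exact ((continuousAt_const.mul h2).neg).sub (continuousAt_const.mul (h1.pow 2))
    exact (ContinuousAt.comp (f := fun y : Euc n => Real.log ‖y‖) hR (hlogc x hx0).continuousAt).mul
      (continuous_norm.continuousAt.rpow_const (Or.inl (norm_ne_zero_iff.2 hx0)))
  refine ⟨hRint, ?_⟩
  set N : ℝ → ℝ := fun t => Real.exp (-p * t) * (1 + θ t) with hN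
  set G : Euc n → ℝ := fun x => N (Real.log ‖x‖) * |u x| ^ p with hG
  have hGc : HasCompactSupport G := hasCompactSupport_mul_abs_rpow _ hp0 hu.hasCompactSupport
  have hG0 : ∀ x ∉ tsupport u, G =ᶠ[nhds x] 0 := fun x hx => by
    filter_upwards [notMem_tsupport_iff_eventuallyEq.1 hx] with y hy
    simp [hG, hy, Real.zero_rpow hp0.ne']
  have hGd : ContDiff ℝ 1 G := by
    refine contDiff_iff_contDiffAt.2 fun x => ?_
    by_cases hx : x ∈ tsupport u
    · have hNc : ContDiffAt ℝ 1 N (Real.log ‖x‖) :=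
        ((contDiffAt_const.mul contDiffAt_id).exp).mul
          (contDiffAt_const.add (hθat _ (hlt x hx)))
      exact (ContDiffAt.comp x hNc (hlogc x (hne x hx))).mul (hu1.norm_rpow hp).contDiffAt
    · exact (contDiffAt_const (c := (0 : ℝ))).congr_of_eventuallyEq (hG0 x hx)
  have hpt : ∀ x, κ * (fderiv ℝ G x x + n * G x) +
      hardyRemainder n p θ (Real.log ‖x‖) * ‖x‖ ^ (-p) * |u x| ^ p ≤
      ‖gradient u x‖ ^ p - |s| ^ p * (‖x‖ ^ (-p) * |u x| ^ p) := by
    intro x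
    by_cases hx : x ∈ tsupport u
    swap
    · rw [(hG0 x hx).fderiv_eq, (hG0 x hx).eq_of_nhds, image_eq_zero_of_notMem_tsupport hx]
      simp only [abs_zero, Real.zero_rpow hp0.ne']
      simp
      positivity
    have hx0 := hne x hx
    have hnx : 0 < ‖x‖ := norm_pos_iff.2 hx0
    set t := Real.log ‖x‖ with ht
    have hE : Real.exp (-p * t) = ‖x‖ ^ (-p) := by
      rw [Real.rpow_def_of_pos hnx, mul_comm]
    have hNd : HasDerivAt N (Real.exp (-p * t) * (-p * (1 + θ t) + deriv θ t)) t := by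
      have h1 : HasDerivAt (fun r : ℝ => Real.exp (-p * r)) (Real.exp (-p * t) * (-p)) t := by
        simpa using ((hasDerivAt_id t).const_mul (-p)).exp
      have h2 := ((hθat t (hlt x hx)).differentiableAt one_ne_zero).hasDerivAt.const_add 1
      exact (h1.mul h2).congr_deriv (by ring)
    have hnorm : DifferentiableAt ℝ (fun y : Euc n => ‖y‖) x :=
      (contDiffAt_norm ℝ hx0 (n := 1)).differentiableAt one_ne_zero
    have hlogd := hnorm.hasFDerivAt.log hnx.ne'
    have hud := (hasDerivAt_abs_rpow (u x) hp).comp_hasFDerivAt x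
      (hu1.differentiable one_ne_zero x).hasFDerivAt
    have hGD := (hNd.comp_hasFDerivAt x hlogd).mul hud
    have hfd : fderiv ℝ G x x = ‖x‖ ^ (-p) *
        ((1 + θ t) * (p * |u x| ^ (p - 2) * u x * fderiv ℝ u x x) + (-p * (1 + θ t) + deriv θ t) * |u x| ^ p) := by
      have h := hGD.fderiv
      have h' : fderiv ℝ G x = _ := h
      rw [h']
      have hself : fderiv ℝ (fun y : Euc n => ‖y‖) x x = ‖x‖ := hnorm.fderiv_norm_self
      simp only [Function.comp, add_apply, smul_apply,
        smul_eq_mul, hself, ← ht, hN, hE]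
      field_simp
    have hGx : G x = ‖x‖ ^ (-p) * (1 + θ t) * |u x| ^ p := by
      simp only [hG, hN, ← ht, hE]
    set a := fderiv ℝ u x x with ha
    have hE0 : 0 < ‖x‖ ^ (-p) := Real.rpow_pos_of_pos hnx _
    have hgrad : ‖x‖ ^ (-p) * |a| ^ p ≤ ‖gradient u x‖ ^ p := by
      have h1 : |a| ≤ ‖gradient u x‖ * ‖x‖ := by
        rw [norm_gradient]; exact (fderiv ℝ u x).le_opNorm x
      calc ‖x‖ ^ (-p) * |a| ^ p ≤ ‖x‖ ^ (-p) * (‖gradient u x‖ * ‖x‖) ^ p := by gcongr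
        _ = ‖gradient u x‖ ^ p := by
          rw [Real.mul_rpow (norm_nonneg _) hnx.le, Real.rpow_neg hnx.le]
          have := (Real.rpow_pos_of_pos hnx p).ne'
          field_simp
    have hsm := hθs t (hlt x hx)
    have hβ : 1 ≤ p / (p - 1) := by rw [le_div_iff₀ hp1]; linarith
    have hθ1 : 0 ≤ 1 + θ t := by
      have : |θ t| ≤ 1 := by nlinarith [abs_nonneg (θ t)]
      linarith [(abs_le.1 this).1]
    have hyoung := young_tangent_le hp s a (u x) hθ1
    have hquad := one_add_rpow_le_quadratic hβ hsm
    have hsκ : κ * (p - n) = p * |s| ^ p := by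
      have hps : p - n = p * s := by rw [hs, hardyExponent]; field_simp
      have hss : |s| ^ (p - 2) * (s * s) = |s| ^ p := by
        rcases eq_or_ne s 0 with h0 | h0
        · simp [h0, Real.zero_rpow hp0.ne']
        · rw [← abs_mul_abs_self s, ← mul_assoc, ← Real.rpow_add_one (abs_pos.2 h0).ne',
            ← Real.rpow_add_one (abs_pos.2 h0).ne']
          congr 1; ring
      rw [hps, hκ]
      linear_combination p * hss
    have hS : 0 ≤ |s| ^ p := by positivity
    have hU : 0 ≤ |u x| ^ p := by positivity
    set β := p / (p - 1) with hβd
    have hβp : (p - 1) * β = p := by rw [hβd]; field_simp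
    have hq2 : (p - 1) * |s| ^ p * (1 + θ t) ^ β ≤
        (p - 1) * |s| ^ p * (1 + β * θ t + 8 * β ^ 2 * θ t ^ 2) := by gcongr
    have hq3 := mul_le_mul_of_nonneg_right hq2 hU
    have hmain : κ * ((1 + θ t) * (p * |u x| ^ (p - 2) * u x * a)
        + (-p * (1 + θ t) + deriv θ t) * |u x| ^ p + n * ((1 + θ t) * |u x| ^ p))
        + hardyRemainder n p θ t * |u x| ^ p + |s| ^ p * |u x| ^ p ≤ |a| ^ p := by
      rw [hardyRemainder, ← hs, ← hκ, ← hβd]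
      have e1 : (p - 1) * |s| ^ p * (1 + β * θ t + 8 * β ^ 2 * θ t ^ 2) * |u x| ^ p
          = (p * |s| ^ p * (1 + θ t) - |s| ^ p + 8 * (p - 1) * β ^ 2 * |s| ^ p * θ t ^ 2)
            * |u x| ^ p := by
        linear_combination (|s| ^ p * θ t * |u x| ^ p) * hβp
      rw [e1] at hq3
      have e2 : κ * ((-p * (1 + θ t)) * |u x| ^ p + n * ((1 + θ t) * |u x| ^ p))
          = -(p * |s| ^ p * (1 + θ t)) * |u x| ^ p := by
        linear_combination (-(1 + θ t) * |u x| ^ p) * hsκ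
      linarith
    have hfin := (mul_le_mul_of_nonneg_left hmain hE0.le).trans hgrad
    rw [hfd, hGx]
    linarith
  have hGint : Integrable G := hGd.continuous.integrable_of_hasCompactSupport hGc
  have hGfd : Integrable fun x => fderiv ℝ G x x := by
    refine Continuous.integrable_of_hasCompactSupport
      ((hGd.continuous_fderiv one_ne_zero).clm_apply continuous_id) ?_
    refine (hGc.fderiv ℝ).mono' (subset_trans (fun x hx => ?_) subset_closure)
    contrapose! hx
    simp only [Function.mem_support, ne_eq, not_not] at hx ⊢
    simp [hx]
  have hzero : ∫ x, κ * (fderiv ℝ G x x + n * G x) = 0 := by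
    rw [integral_const_mul, integral_add hGfd (hGint.const_mul _), integral_const_mul,
      integral_fderiv_apply_self hGd hGc]
    ring
  rw [hdiff]
  have hint1 : Integrable fun x => κ * (fderiv ℝ G x x + n * G x) :=
    (hGfd.add (hGint.const_mul _)).const_mul _
  calc ∫ x, hardyRemainder n p θ (Real.log ‖x‖) * ‖x‖ ^ (-p) * |u x| ^ p
      = ∫ x, (κ * (fderiv ℝ G x x + n * G x) +
        hardyRemainder n p θ (Real.log ‖x‖) * ‖x‖ ^ (-p) * |u x| ^ p) := by
        rw [integral_add hint1 hRint, hzero, zero_add]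
    _ ≤ _ := integral_mono (hint1.add hRint)
      ((integrable_norm_gradient_rpow hp0 hu1 hu.hasCompactSupport).sub (hI.const_mul _)) hpt

lemma IsBoundedDomainAtZero.norm_le_diam {n : ℕ} {Ω : Set (Euc n)} (hΩ : IsBoundedDomainAtZero Ω)
    {x : Euc n} (hx : x ∈ Ω) : ‖x‖ ≤ Metric.diam Ω := by
  simpa using Metric.dist_le_diam_of_mem hΩ.isBounded hx hΩ.zero_mem

lemma IsBoundedDomainAtZero.log_norm_le {n : ℕ} {Ω : Set (Euc n)} (hΩ : IsBoundedDomainAtZero Ω)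
    {x : Euc n} (hx : x ∈ Ω) (hx0 : x ≠ 0) : Real.log ‖x‖ ≤ Real.log (Metric.diam Ω) :=
  Real.log_le_log (norm_pos_iff.2 hx0) (hΩ.norm_le_diam hx)

lemma hardyDifference_nonneg {n : ℕ} {p : ℝ} (hp : 1 < p) {Ω : Set (Euc n)}
    (hΩ : IsBoundedDomainAtZero Ω) {u : Euc n → ℝ} (hu : IsTestFunctionOn (Ω \ {0}) u) :
    0 ≤ hardyDifference p Ω u := by
  have h := (integral_hardyRemainder_le hp hu (T := Real.log (Metric.diam Ω) + 1) (θ := fun _ => 0)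
    (fun x hx hx0 => by linarith [hΩ.log_norm_le hx hx0]) contDiffOn_const (by simp)).2
  simpa [hardyRemainder] using h

/-! ### Improvement by logistic weights -/

/-- The weight `σ (1 - σ) / (L - t)`, where `σ` is the logistic function of scale `1 / δ` centred at
`t₀`; as a function of `t = log |x|` it is concentrated around the sphere `|x| = exp t₀`. -/
noncomputable def logisticWeight (δ t₀ L t : ℝ) : ℝ :=
  Real.sigmoid (δ * (t - t₀)) * (1 - Real.sigmoid (δ * (t - t₀))) / (L - t)

lemma logisticWeight_nonneg (δ t₀ : ℝ) {L t : ℝ} (h : t ≤ L) : 0 ≤ logisticWeight δ t₀ L t := by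
  have h1 := Real.sigmoid_nonneg (δ * (t - t₀))
  have h2 := Real.sigmoid_le_one (δ * (t - t₀))
  exact div_nonneg (mul_nonneg h1 (by linarith)) (by linarith)

/-- Hardy's inequality improved by a logistic weight, with a constant that does not depend on the
centre `t₀` of the weight. -/
lemma exists_mul_integral_logisticWeight_le {n : ℕ} {p δ : ℝ} (hp : 1 < p) (hpn : p ≠ n)
    (hδ : 0 < δ) :
    ∃ c : ℝ, 0 < c ∧ ∀ Ω : Set (Euc n), IsBoundedDomainAtZero Ω → ∀ u : Euc n → ℝ,
      IsTestFunctionOn (Ω \ {0}) u → ∀ t₀ : ℝ,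
      Integrable (fun x => logisticWeight δ t₀ (Real.log (Metric.diam Ω) + 2) (Real.log ‖x‖) *
        ‖x‖ ^ (-p) * |u x| ^ p) ∧
      c * ∫ x, logisticWeight δ t₀ (Real.log (Metric.diam Ω) + 2) (Real.log ‖x‖) *
        ‖x‖ ^ (-p) * |u x| ^ p ≤ hardyDifference p Ω u := by
  have hp0 : 0 < p := by linarith
  have hp1 : 0 < p - 1 := by linarith
  set s := hardyExponent n p with hs
  have hs0 : 0 < |s| := by
    rw [abs_pos, hs, hardyExponent]
    exact div_ne_zero (sub_ne_zero.2 hpn) hp0.ne'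
  set β := p / (p - 1) with hβ
  have hβ0 : 0 < β := by positivity
  -- The first summand makes the perturbation small, the second makes its linear effect dominate the
  -- quadratic one.
  set ε : ℝ := 1 / (4 * β + 8 * (p - 1) * β ^ 2 * |s|) with hε
  have hε0 : 0 < ε := by positivity
  have hεmul : ε * (4 * β + 8 * (p - 1) * β ^ 2 * |s|) = 1 := by rw [hε]; field_simp
  have hε1 : ε * (4 * β) ≤ 1 := by
    have : 0 ≤ ε * (8 * (p - 1) * β ^ 2 * |s|) := by positivity
    linarith
  have hε2 : 8 * (p - 1) * β ^ 2 * |s| * ε ≤ 1 := by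
    have : 0 ≤ ε * (4 * β) := by positivity
    linarith
  refine ⟨ε * |s| ^ (p - 1) * δ, by positivity, fun Ω hΩ u hu t₀ => ?_⟩
  set L := Real.log (Metric.diam Ω) + 2 with hL
  have hu1 : ContDiff ℝ 1 u := hu.contDiff.of_le (by norm_cast)
  have hne : ∀ x ∈ tsupport u, x ≠ 0 := fun x hx => (hu.tsupport_subset hx).2
  have hW : Integrable fun x => logisticWeight δ t₀ L (Real.log ‖x‖) * ‖x‖ ^ (-p) * |u x| ^ p := by
    refine integrable_mul_abs_rpow hp0 hu1.continuous hu.hasCompactSupport fun x hx => ?_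
    have hnx : ‖x‖ ≠ 0 := norm_ne_zero_iff.2 (hne x hx)
    have hLx : L - Real.log ‖x‖ ≠ 0 := by
      have := hΩ.log_norm_le (hu.tsupport_subset hx).1 (hne x hx)
      rw [hL]; linarith
    have hlog : ContinuousAt (fun y : Euc n => Real.log ‖y‖) x := continuousAt_id.norm.log hnx
    have hsig : ContinuousAt (fun y : Euc n => Real.sigmoid (δ * (Real.log ‖y‖ - t₀))) x :=
      ContinuousAt.comp (g := Real.sigmoid) continuous_sigmoid.continuousAt
        (continuousAt_const.mul (hlog.sub continuousAt_const))
    exact ((hsig.mul (continuousAt_const.sub hsig)).div (continuousAt_const.sub hlog) hLx).mul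
      (continuousAt_id.norm.rpow_const (Or.inl hnx))
  refine ⟨hW, ?_⟩
  set A : ℝ := -ε * (s / |s|) with hA
  set θ : ℝ → ℝ := fun t => A * (Real.sigmoid (δ * (t - t₀)) / (L - t)) with hθ
  have hθder : ∀ t < L - 1, HasDerivAt θ (A * (δ * logisticWeight δ t₀ L t +
      Real.sigmoid (δ * (t - t₀)) / (L - t) ^ 2)) t := by
    intro t ht
    have h0 : L - t ≠ 0 := by linarith
    have h1 : HasDerivAt (fun r : ℝ => δ * (r - t₀)) δ t := by
      simpa using ((hasDerivAt_id t).sub_const t₀).const_mul δ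
    have h2 := (Real.hasDerivAt_sigmoid (δ * (t - t₀))).comp t h1
    have h3 : HasDerivAt (fun r : ℝ => L - r) (-1) t := by
      simpa using (hasDerivAt_id t).const_sub L
    refine ((h2.div h3 h0).const_mul A).congr_deriv ?_
    simp only [Function.comp, logisticWeight]
    field_simp
    ring
  have habsA : |A| = ε := by
    rw [hA, abs_mul, abs_neg, abs_of_pos hε0, abs_div, abs_abs, div_self hs0.ne', mul_one]
  have hsig0 : ∀ t, 0 ≤ Real.sigmoid (δ * (t - t₀)) := fun t => Real.sigmoid_nonneg _
  have hsig1 : ∀ t, Real.sigmoid (δ * (t - t₀)) ≤ 1 := fun t => Real.sigmoid_le_one _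
  have key := integral_hardyRemainder_le hp hu (T := L - 1) (θ := θ)
    (fun x hx hx0 => by rw [hL]; linarith [hΩ.log_norm_le hx hx0]) ?_ ?_
  · rw [← integral_const_mul]
    refine le_trans (integral_mono (hW.const_mul _) key.1 fun x => ?_) key.2
    by_cases hx : x ∈ tsupport u
    swap
    · simp [image_eq_zero_of_notMem_tsupport hx, Real.zero_rpow hp0.ne']
    set t := Real.log ‖x‖ with ht
    have hxΩ := hΩ.log_norm_le (hu.tsupport_subset hx).1 (hne x hx)
    have hLt : 0 < L - t := by rw [hL]; linarith
    set S := Real.sigmoid (δ * (t - t₀)) with hS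
    have hrem : ε * |s| ^ (p - 1) * δ * logisticWeight δ t₀ L t ≤ hardyRemainder n p θ t := by
      rw [hardyRemainder, (hθder t (by rw [hL]; linarith)).deriv, ← hs, ← hβ]
      have e1 : |s| ^ (p - 2) * s * A = -(ε * |s| ^ (p - 1)) := by
        have h1 : |s| ^ (p - 1) = |s| ^ (p - 2) * |s| := by
          rw [← Real.rpow_add_one hs0.ne']; congr 1; ring
        rw [hA, h1]
        have : s * (s / |s|) = |s| := by
          rw [← mul_div_assoc, ← abs_mul_abs_self s]; field_simp
        linear_combination (-ε * |s| ^ (p - 2)) * this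
      have e2 : |s| ^ p = |s| ^ (p - 1) * |s| := by
        rw [← Real.rpow_add_one hs0.ne']; congr 1; ring
      have e3 : θ t ^ 2 = ε ^ 2 * (S ^ 2 / (L - t) ^ 2) := by
        simp only [hθ]
        rw [mul_pow, div_pow, ← sq_abs A, habsA]
      have e4 : 8 * (p - 1) * β ^ 2 * |s| ^ p * θ t ^ 2
          ≤ ε * |s| ^ (p - 1) * (S / (L - t) ^ 2) := by
        rw [e2, e3]
        have hS0 : 0 ≤ S := hsig0 t
        have hSS : S ^ 2 ≤ S := by nlinarith [hsig1 t]
        calc 8 * (p - 1) * β ^ 2 * (|s| ^ (p - 1) * |s|) * (ε ^ 2 * (S ^ 2 / (L - t) ^ 2))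
            = (8 * (p - 1) * β ^ 2 * |s| * ε) * (ε * |s| ^ (p - 1) * (S ^ 2 / (L - t) ^ 2)) := by
              ring
          _ ≤ 1 * (ε * |s| ^ (p - 1) * (S / (L - t) ^ 2)) := by gcongr
          _ = _ := one_mul _
      have e5 : |s| ^ (p - 2) * s * (A * (δ * logisticWeight δ t₀ L t + S / (L - t) ^ 2))
          = -(ε * |s| ^ (p - 1)) * (δ * logisticWeight δ t₀ L t + S / (L - t) ^ 2) := by
        rw [← e1]; ring
      rw [e5]
      linarith
    have hnn : 0 ≤ ‖x‖ ^ (-p) * |u x| ^ p := by positivity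
    calc ε * |s| ^ (p - 1) * δ * (logisticWeight δ t₀ L t * ‖x‖ ^ (-p) * |u x| ^ p)
        = ε * |s| ^ (p - 1) * δ * logisticWeight δ t₀ L t * (‖x‖ ^ (-p) * |u x| ^ p) := by ring
      _ ≤ hardyRemainder n p θ t * (‖x‖ ^ (-p) * |u x| ^ p) := by gcongr
      _ = _ := by ring
  · have hsigc : ContDiff ℝ 1 fun t => Real.sigmoid (δ * (t - t₀)) :=
      (contDiff_sigmoid.of_le le_top).comp (by fun_prop)
    refine contDiffOn_const.mul (hsigc.contDiffOn.div (by fun_prop) fun t ht => ?_)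
    have : t < L - 1 := ht
    linarith
  · intro t ht
    have h0 : 1 < L - t := by linarith
    have h1 : Real.sigmoid (δ * (t - t₀)) / (L - t) ≤ 1 := by
      rw [div_le_one (by linarith)]; linarith [hsig1 t]
    have h2 : 0 ≤ Real.sigmoid (δ * (t - t₀)) / (L - t) := div_nonneg (hsig0 t) (by linarith)
    have h3 : |θ t| ≤ ε := by
      simp only [hθ]
      rw [abs_mul, habsA, abs_of_nonneg h2]
      nlinarith
    calc |θ t| * (4 * β) ≤ ε * (4 * β) := by gcongr
      _ ≤ 1 := hε1

lemma sigmoid_mul_one_sub_sigmoid (z : ℝ) :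
    Real.sigmoid z * (1 - Real.sigmoid z) = Real.exp z / (1 + Real.exp z) ^ 2 := by
  rw [Real.sigmoid_def, Real.exp_neg]
  have := Real.exp_pos z
  field_simp
  ring

lemma logisticWeight_log {δ d y : ℝ} (L : ℝ) (hd : 0 < d) (hy : 0 < y) :
    logisticWeight δ (Real.log d) L (Real.log y) =
      (y / d) ^ δ / (1 + (y / d) ^ δ) ^ 2 / (L - Real.log y) := by
  rw [logisticWeight, sigmoid_mul_one_sub_sigmoid, ← Real.log_div hy.ne' hd.ne', mul_comm δ,
    ← Real.rpow_def_of_pos (by positivity)]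

/-- On a ball of radius `r` a suitably centred logistic weight controls a power of `min 1 (|x| /
r)`, up to the factor `1 - log (r / D)`. The weight is centred at scale `r` if the ball is close
to the origin, and at the scale of its distance to the origin otherwise. -/
lemma exists_min_rpow_le_logisticWeight {δ : ℝ} (hδ : 0 < δ) :
    ∃ M : ℝ, 0 < M ∧ ∀ (n : ℕ) (c : Euc n) (r R D : ℝ), 0 < r → r ≤ R → R ≤ D →
      ∃ t₀ : ℝ, ∀ x ∈ Metric.ball c r, x ≠ 0 → ‖x‖ ≤ R →
        min 1 (‖x‖ / r) ^ (2 * δ) ≤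
          M * (1 - Real.log (r / D)) * logisticWeight δ t₀ (Real.log R + 2) (Real.log ‖x‖) := by
  set b : ℝ := 3 ^ δ with hb
  have hb1 : 1 ≤ b := Real.one_le_rpow (by norm_num) hδ.le
  refine ⟨(1 + b) ^ 2 * (2 * b + 1 / δ), by positivity, fun n c r R D hr hrR hRD => ?_⟩
  have hR : 0 < R := hr.trans_le hrR
  have hD : 0 < D := hR.trans_le hRD
  set K := 1 - Real.log (r / D) with hK
  have hlogRD := Real.log_le_log hR hRD
  have hKeq : K = 1 + Real.log D - Real.log r := by
    rw [hK, Real.log_div hr.ne' hD.ne']; ring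
  have hK1 : 1 ≤ K := by
    have := Real.log_le_log hr hrR
    rw [hKeq]; linarith
  have hle : ∀ {a τ m : ℝ}, 0 < a → a ≤ b → 0 < τ → m * τ ≤ (2 * b + 1 / δ) * K * a →
      m ≤ (1 + b) ^ 2 * (2 * b + 1 / δ) * K * (a / (1 + a) ^ 2 / τ) := by
    intro a τ m ha hab hτ hm
    have h1 : (1 + a) ^ 2 ≤ (1 + b) ^ 2 := by gcongr
    calc m ≤ (2 * b + 1 / δ) * K * a / τ := by rwa [le_div_iff₀ hτ]
      _ = (1 + a) ^ 2 * ((2 * b + 1 / δ) * K * (a / (1 + a) ^ 2 / τ)) := by field_simp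
      _ ≤ (1 + b) ^ 2 * ((2 * b + 1 / δ) * K * (a / (1 + a) ^ 2 / τ)) := by gcongr
      _ = _ := by ring
  rcases le_or_gt ‖c‖ (2 * r) with hc | hc
  · refine ⟨Real.log r, fun x hx hx0 hxR => ?_⟩
    have hnx : 0 < ‖x‖ := norm_pos_iff.2 hx0
    have hxc : ‖x - c‖ < r := by rwa [Metric.mem_ball, dist_eq_norm] at hx
    have hx3 : ‖x‖ < 3 * r := by
      have := norm_le_insert' x c
      linarith
    rw [logisticWeight_log _ hr hnx]
    set y := ‖x‖ / r with hy
    have hy0 : 0 < y := by positivity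
    have hy3 : y ≤ 3 := by rw [hy, div_le_iff₀ hr]; exact hx3.le
    have ha0 : 0 < y ^ δ := by positivity
    have hab : y ^ δ ≤ b := by rw [hb]; gcongr
    have hlogx := Real.log_le_log hnx hxR
    refine hle ha0 hab (by linarith) ?_
    have hmin : min 1 y ^ (2 * δ) ≤ y ^ δ * y ^ δ := by
      rw [← Real.rpow_add hy0, two_mul]
      have : 0 ≤ min 1 y := le_min zero_le_one hy0.le
      exact Real.rpow_le_rpow this (min_le_right _ _) (by linarith)
    have hlogy : -Real.log y ≤ (y ^ δ)⁻¹ / δ := by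
      rw [← Real.log_inv, ← Real.inv_rpow hy0.le]
      exact Real.log_le_rpow_div (by positivity) hδ
    have hτ : Real.log R + 2 - Real.log ‖x‖ ≤ 2 * K + (y ^ δ)⁻¹ / δ := by
      have : Real.log y = Real.log ‖x‖ - Real.log r := Real.log_div hnx.ne' hr.ne'
      linarith
    calc min 1 y ^ (2 * δ) * (Real.log R + 2 - Real.log ‖x‖)
        ≤ (y ^ δ * y ^ δ) * (2 * K + (y ^ δ)⁻¹ / δ) := by
          apply mul_le_mul hmin hτ (by linarith) (by positivity)
      _ = (2 * y ^ δ * K + 1 / δ) * y ^ δ := by field_simp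
      _ ≤ ((2 * b + 1 / δ) * K) * y ^ δ := by
          gcongr
          have h1 : 2 * y ^ δ * K ≤ 2 * b * K := by gcongr
          have h2 : 1 / δ ≤ 1 / δ * K := le_mul_of_one_le_right (by positivity) hK1
          linarith
  · have hc0 : 0 < ‖c‖ := by linarith
    refine ⟨Real.log ‖c‖, fun x hx hx0 hxR => ?_⟩
    have hnx : 0 < ‖x‖ := norm_pos_iff.2 hx0
    have hxc : ‖x - c‖ < r := by rwa [Metric.mem_ball, dist_eq_norm] at hx
    have hxhi : ‖x‖ ≤ 3 * ‖c‖ := by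
      have := norm_le_insert' x c
      linarith
    have hxlo : ‖c‖ < ‖x‖ + r := by
      have := norm_le_insert x c
      linarith
    rw [logisticWeight_log _ hc0 hnx]
    set y := ‖x‖ / ‖c‖ with hy
    have hy0 : 0 < y := by positivity
    have hy3 : y ≤ 3 := by rw [hy, div_le_iff₀ hc0]; exact hxhi
    have hy2 : 1 / 3 ≤ y := by rw [hy, le_div_iff₀ hc0]; linarith
    have ha0 : 0 < y ^ δ := by positivity
    have hab : y ^ δ ≤ b := by rw [hb]; gcongr
    have hba : 1 ≤ b * y ^ δ := by
      rw [hb, ← Real.mul_rpow (by norm_num) hy0.le]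
      exact Real.one_le_rpow (by linarith) hδ.le
    have hlogx := Real.log_le_log hnx hxR
    have hlogr := Real.log_le_log hr (by linarith : r ≤ ‖x‖)
    refine hle ha0 hab (by linarith) ?_
    have hmin : min 1 (‖x‖ / r) ^ (2 * δ) ≤ 1 :=
      Real.rpow_le_one (le_min zero_le_one (by positivity)) (min_le_left _ _) (by linarith)
    calc min 1 (‖x‖ / r) ^ (2 * δ) * (Real.log R + 2 - Real.log ‖x‖) ≤ 1 * (2 * K) := by
          apply mul_le_mul hmin (by linarith) (by linarith) zero_le_one
      _ = 2 * K * 1 := by ring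
      _ ≤ 2 * K * (b * y ^ δ) := by gcongr
      _ ≤ 2 * K * (b * y ^ δ) + 1 / δ * K * y ^ δ := by
          have : 0 ≤ 1 / δ * K * y ^ δ := by positivity
          linarith
      _ = (2 * b + 1 / δ) * K * y ^ δ := by ring

/-! ### Hölder's inequality on balls -/

lemma volume_real_ball {n : ℕ} (c : Euc n) {r : ℝ} (hr : 0 < r) :
    volume.real (Metric.ball c r) = r ^ n * volume.real (Metric.ball (0 : Euc n) 1) := by
  rw [measureReal_def, Measure.addHaar_ball_of_pos volume c hr, ENNReal.toReal_mul, measureReal_def,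
    ENNReal.toReal_ofReal (by positivity), finrank_euclideanSpace_fin]

lemma integral_ball_inv_norm {n : ℕ} (hn : 2 ≤ n) {r : ℝ} (hr : 0 < r) :
    IntegrableOn (fun x : Euc n => r / ‖x‖) (Metric.ball 0 r) ∧
    ∫ x in Metric.ball (0 : Euc n) r, r / ‖x‖ ≤ 2 * volume.real (Metric.ball (0 : Euc n) r) := by
  obtain ⟨k, rfl⟩ : ∃ k, n = k + 2 := ⟨n - 2, by omega⟩
  have hpow : ∀ y : ℝ, 0 < y → y ^ (k + 1) * (r / y) = r * y ^ k := fun y hy => by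
    rw [pow_succ]; field_simp
  have hint : IntegrableOn (fun y : ℝ => r * y ^ k) (Set.Ioo 0 r) :=
    (Continuous.integrableOn_Icc (by fun_prop)).mono_set Set.Ioo_subset_Icc_self
  refine ⟨?_, ?_⟩
  · refine (integrableOn_fun_norm_addHaar volume (f := fun y => r / y)).2 ?_
    refine hint.congr_fun (fun y hy => ?_) measurableSet_Ioo
    simp only [finrank_euclideanSpace_fin, smul_eq_mul]
    exact (hpow y hy.1).symm
  · have h := integral_fun_norm_addHaar (volume : Measure (Euc (k + 2)))
      ((Set.Iio r).indicator fun y => r / y)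
    have hL : ∫ x : Euc (k + 2), (Set.Iio r).indicator (fun y => r / y) ‖x‖
        = ∫ x in Metric.ball (0 : Euc (k + 2)) r, r / ‖x‖ := by
      rw [← integral_indicator measurableSet_ball]
      congr 1; ext x
      simp [Set.indicator]
    have hR : ∫ y in Set.Ioi (0 : ℝ), y ^ (Module.finrank ℝ (Euc (k + 2)) - 1) •
        (Set.Iio r).indicator (fun y => r / y) y = r ^ (k + 2) / (k + 1) := by
      have h1 : ∀ y ∈ Set.Ioi (0 : ℝ), y ^ (Module.finrank ℝ (Euc (k + 2)) - 1) •
          (Set.Iio r).indicator (fun y => r / y) y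
          = (Set.Iio r).indicator (fun y => r * y ^ k) y := by
        intro y hy
        by_cases hyr : y < r
        · simpa [Set.indicator, hyr] using hpow y hy
        · simp [Set.indicator, hyr]
      rw [setIntegral_congr_fun measurableSet_Ioi h1, setIntegral_indicator measurableSet_Iio,
        Set.Ioi_inter_Iio, ← integral_Ioc_eq_integral_Ioo,
        ← intervalIntegral.integral_of_le hr.le, intervalIntegral.integral_const_mul, integral_pow]
      simp
      ring
    rw [← hL, h, hR, volume_real_ball _ hr, finrank_euclideanSpace_fin]
    simp only [nsmul_eq_mul, smul_eq_mul]
    push_cast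
    have hk : ((k : ℝ) + 2) / (k + 1) ≤ 2 := by
      rw [div_le_iff₀ (by positivity)]
      have : (0 : ℝ) ≤ k := by positivity
      linarith
    calc ((k : ℝ) + 2) * (volume.real (Metric.ball (0 : Euc (k + 2)) 1) * (r ^ (k + 2) / (k + 1)))
        = ((k : ℝ) + 2) / (k + 1) *
            (r ^ (k + 2) * volume.real (Metric.ball (0 : Euc (k + 2)) 1)) := by
          ring
      _ ≤ 2 * (r ^ (k + 2) * volume.real (Metric.ball (0 : Euc (k + 2)) 1)) := by gcongr

lemma inv_min_one_div_norm_le {n : ℕ} {r : ℝ} (hr : 0 < r) (x : Euc n) :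
    (min 1 (‖x‖ / r))⁻¹ ≤ 1 + (Metric.ball (0 : Euc n) r).indicator (fun x => r / ‖x‖) x := by
  have h0 : 0 ≤ r / ‖x‖ := by positivity
  by_cases hx : ‖x‖ < r
  · have h1 : ‖x‖ / r ≤ 1 := by rw [div_le_one hr]; exact hx.le
    simp [Set.indicator, hx, min_eq_right h1]
  · have h1 : 1 ≤ ‖x‖ / r := by rw [le_div_iff₀ hr]; linarith
    simp [Set.indicator, hx, min_eq_left h1]

lemma integral_ball_inv_min_one_div_norm {n : ℕ} (hn : 2 ≤ n) (c : Euc n) {r : ℝ} (hr : 0 < r) :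
    IntegrableOn (fun x : Euc n => (min 1 (‖x‖ / r))⁻¹) (Metric.ball c r) ∧
    ∫ x in Metric.ball c r, (min 1 (‖x‖ / r))⁻¹ ≤ 3 * volume.real (Metric.ball c r) := by
  obtain ⟨hi, hle⟩ := integral_ball_inv_norm hn hr
  have hi' := hi.integrable_indicator measurableSet_ball
  have h1 : IntegrableOn (fun _ : Euc n => (1 : ℝ)) (Metric.ball c r) :=
    integrableOn_const measure_ball_lt_top.ne
  have hs : IntegrableOn (fun x : Euc n =>
      1 + (Metric.ball (0 : Euc n) r).indicator (fun x => r / ‖x‖) x) (Metric.ball c r) :=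
    h1.add hi'.integrableOn
  have hint : IntegrableOn (fun x : Euc n => (min 1 (‖x‖ / r))⁻¹) (Metric.ball c r) := by
    refine Integrable.mono' hs (Measurable.aestronglyMeasurable (by fun_prop))
      (.of_forall fun x => ?_)
    rw [Real.norm_of_nonneg (inv_nonneg.2 (le_min zero_le_one (by positivity)))]
    exact inv_min_one_div_norm_le hr x
  refine ⟨hint, ?_⟩
  have hnn : ∀ x : Euc n, 0 ≤ (Metric.ball (0 : Euc n) r).indicator (fun x => r / ‖x‖) x :=
    fun x => Set.indicator_nonneg (fun y _ => by positivity) x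
  calc ∫ x in Metric.ball c r, (min 1 (‖x‖ / r))⁻¹
      ≤ ∫ x in Metric.ball c r, (1 + (Metric.ball (0 : Euc n) r).indicator (fun x => r / ‖x‖) x) :=
        integral_mono hint hs (inv_min_one_div_norm_le hr)
    _ = volume.real (Metric.ball c r) +
        ∫ x in Metric.ball c r, (Metric.ball (0 : Euc n) r).indicator (fun x => r / ‖x‖) x := by
        rw [integral_add h1 hi'.integrableOn]; simp
    _ ≤ volume.real (Metric.ball c r) +
        ∫ x, (Metric.ball (0 : Euc n) r).indicator (fun x => r / ‖x‖) x := by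
        gcongr
        · exact .of_forall hnn
        · exact Measure.restrict_le_self
    _ ≤ volume.real (Metric.ball c r) + 2 * volume.real (Metric.ball c r) := by
        rw [integral_indicator measurableSet_ball, volume_real_ball c hr,
          ← volume_real_ball 0 hr]
        gcongr
    _ = _ := by ring

/-- Hölder's inequality on a ball, with the weight `min 1 (|x| / r)` raised to the power that makes
the dual integrand `(min 1 (|x| / r))⁻¹`. -/
lemma setIntegral_ball_rpow_le {n : ℕ} (hn : 2 ≤ n) {p q : ℝ} (hq : 1 ≤ q) (hqp : q < p)
    {u : Euc n → ℝ} (hu : Continuous u) (hc : HasCompactSupport u) (h0 : (0 : Euc n) ∉ tsupport u)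
    (c : Euc n) {r : ℝ} (hr : 0 < r) :
    ∫ x in Metric.ball c r, |u x| ^ q / ‖x‖ ^ q ≤
      (∫ x in Metric.ball c r, min 1 (‖x‖ / r) ^ ((p - q) / q) * ‖x‖ ^ (-p) * |u x| ^ p) ^ (q / p) *
      (3 * volume.real (Metric.ball c r)) ^ ((p - q) / p) := by
  have hq0 : 0 < q := by linarith
  have hp0 : 0 < p := by linarith
  have hpq : 0 < p - q := by linarith
  have hm0 : ∀ x : Euc n, 0 ≤ min 1 (‖x‖ / r) := fun x => le_min zero_le_one (by positivity)
  set F : Euc n → ℝ := fun x => min 1 (‖x‖ / r) ^ ((p - q) / p) * ‖x‖ ^ (-q) * |u x| ^ q with hF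
  set g : Euc n → ℝ := fun x => min 1 (‖x‖ / r) ^ (-((p - q) / p)) with hg
  have hconj : (p / q).HolderConjugate (p / (p - q)) := by
    rw [Real.holderConjugate_iff]
    refine ⟨by rw [lt_div_iff₀ hq0]; linarith, ?_⟩
    field_simp; ring
  have hFg : ∀ x, |u x| ^ q / ‖x‖ ^ q = F x * g x := by
    intro x
    by_cases hx : x = 0
    · subst hx
      have : u 0 = 0 := image_eq_zero_of_notMem_tsupport h0
      simp [hF, this, Real.zero_rpow hq0.ne']
    · have hnx : 0 < ‖x‖ := norm_pos_iff.2 hx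
      have hm : 0 < min 1 (‖x‖ / r) := lt_min one_pos (by positivity)
      simp only [hF, hg]
      rw [Real.rpow_neg hm.le, Real.rpow_neg hnx.le]
      have := Real.rpow_pos_of_pos hm ((p - q) / p)
      field_simp
  have hFp : ∀ x, F x ^ (p / q) = min 1 (‖x‖ / r) ^ ((p - q) / q) * ‖x‖ ^ (-p) * |u x| ^ p := by
    intro x
    have hm := hm0 x
    simp only [hF]
    rw [Real.mul_rpow (by positivity) (by positivity),
      Real.mul_rpow (by positivity) (by positivity),
      ← Real.rpow_mul hm, ← Real.rpow_mul (norm_nonneg _), ← Real.rpow_mul (abs_nonneg _)]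
    have e1 : (p - q) / p * (p / q) = (p - q) / q := by field_simp
    have e2 : -q * (p / q) = -p := by field_simp
    have e3 : q * (p / q) = p := by field_simp
    rw [e1, e2, e3]
  have hgp : ∀ x, g x ^ (p / (p - q)) = (min 1 (‖x‖ / r))⁻¹ := by
    intro x
    simp only [hg]
    rw [← Real.rpow_mul (hm0 x), ← Real.rpow_neg_one]
    congr 1
    field_simp
  have hF0 : ∀ x, 0 ≤ F x := fun x => by
    have := hm0 x
    positivity
  have hg0 : ∀ x, 0 ≤ g x := fun x => Real.rpow_nonneg (hm0 x) _
  have hFc : Continuous F := by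
    refine continuous_mul_abs_rpow hq0 hu fun x hx => ?_
    have hx0 : x ≠ 0 := fun h => h0 (h ▸ hx)
    refine ContinuousAt.mul (Continuous.continuousAt ?_)
      (continuous_norm.continuousAt.rpow_const (Or.inl (norm_ne_zero_iff.2 hx0)))
    exact Continuous.rpow_const (by fun_prop) fun _ => Or.inr (by positivity)
  have hFL : MemLp F (ENNReal.ofReal (p / q)) (volume.restrict (Metric.ball c r)) :=
    (hFc.memLp_of_hasCompactSupport (hasCompactSupport_mul_abs_rpow _ hq0 hc)).restrict _
  obtain ⟨hint, hle⟩ := integral_ball_inv_min_one_div_norm hn c hr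
  have hgL : MemLp g (ENNReal.ofReal (p / (p - q))) (volume.restrict (Metric.ball c r)) := by
    have hpos : 0 < p / (p - q) := by positivity
    refine (integrable_norm_rpow_iff (Measurable.aestronglyMeasurable (by fun_prop)) ?_
      ENNReal.ofReal_ne_top).1 ?_
    · simpa using hpos
    · rw [ENNReal.toReal_ofReal hpos.le]
      simp_rw [fun x => Real.norm_of_nonneg (hg0 x), hgp]
      exact hint
  have hH := integral_mul_le_Lp_mul_Lq_of_nonneg hconj (.of_forall hF0) (.of_forall hg0) hFL hgL
  simp_rw [hFp, hgp] at hH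
  simp_rw [hFg]
  refine hH.trans ?_
  rw [one_div_div, one_div_div]
  gcongr

/-! ### The local estimate -/

/-- The estimate holds with `Θ = 0` for all balls, whether `p < n` or `p > n`. -/
lemma exists_localHardyMean_le {n : ℕ} (hn : 2 ≤ n) {p q : ℝ} (hq : 1 ≤ q) (hqp : q < p)
    (hpn : p ≠ n) :
    ∃ C : ℝ, 0 < C ∧ ∀ Ω : Set (Euc n), IsBoundedDomainAtZero Ω → ∀ u : Euc n → ℝ,
      IsTestFunctionOn (Ω \ {0}) u → ∀ (c : Euc n) (r D : ℝ), 0 < r → r < Metric.diam Ω →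
      Metric.diam Ω ≤ D → localHardyMean p q D u c r ≤ C * hardyDifference p Ω u ^ (1 / p) := by
  have hp : 1 < p := by linarith
  have hq0 : 0 < q := by linarith
  have hp0 : 0 < p := by linarith
  have hpq : 0 < p - q := by linarith
  set δ := (p - q) / (2 * q) with hδ
  have hδ0 : 0 < δ := by positivity
  have h2δ : 2 * δ = (p - q) / q := by rw [hδ]; field_simp
  obtain ⟨a, ha, hHardy⟩ := exists_mul_integral_logisticWeight_le hp hpn hδ0
  obtain ⟨M, hM, hweight⟩ := exists_min_rpow_le_logisticWeight hδ0
  set V := volume.real (Metric.ball (0 : Euc n) 1) with hV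
  have hV0 : 0 < V := by
    rw [hV, measureReal_def]
    exact ENNReal.toReal_pos (Metric.measure_ball_pos _ _ one_pos).ne' measure_ball_lt_top.ne
  refine ⟨(M / a) ^ (1 / p) * 3 ^ ((p - q) / (p * q)) * V ^ (-(1 / p)), by positivity,
    fun Ω hΩ u hu c r D hr hrR hRD => ?_⟩
  have hu1 : ContDiff ℝ 1 u := hu.contDiff.of_le (by norm_cast)
  have hne : ∀ x ∈ tsupport u, x ≠ 0 := fun x hx => (hu.tsupport_subset hx).2
  have hI := hardyDifference_nonneg hp hΩ hu
  set I := hardyDifference p Ω u with hIdef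
  set K := 1 - Real.log (r / D) with hK
  have hK0 : 0 < K := by
    have h1 : r / D ≤ 1 := by rw [div_le_one (by linarith)]; linarith
    have h2 : 0 < D := by linarith
    have := Real.log_nonpos (by positivity) h1
    rw [hK]; linarith
  have hm0 : ∀ x : Euc n, 0 ≤ min 1 (‖x‖ / r) := fun x => le_min zero_le_one (by positivity)
  obtain ⟨t₀, ht₀⟩ := hweight n c r (Metric.diam Ω) D hr hrR.le hRD
  obtain ⟨hWint, hWle⟩ := hHardy Ω hΩ u hu t₀
  set L := Real.log (Metric.diam Ω) + 2 with hL
  have hWnn : ∀ x, 0 ≤ logisticWeight δ t₀ L (Real.log ‖x‖) * ‖x‖ ^ (-p) * |u x| ^ p := by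
    intro x
    by_cases hx : x ∈ tsupport u
    · have h1 := hΩ.log_norm_le (hu.tsupport_subset hx).1 (hne x hx)
      have h2 := logisticWeight_nonneg δ t₀ (L := L) (t := Real.log ‖x‖) (by rw [hL]; linarith)
      positivity
    · simp [image_eq_zero_of_notMem_tsupport hx, Real.zero_rpow hp0.ne']
  set J := ∫ x in Metric.ball c r, min 1 (‖x‖ / r) ^ ((p - q) / q) * ‖x‖ ^ (-p) * |u x| ^ p with hJ
  have hJ0 : 0 ≤ J := integral_nonneg fun x => by
    have := hm0 x
    positivity
  have hJle : J ≤ M / a * (K * I) := by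
    have hint : Integrable fun x : Euc n =>
        min 1 (‖x‖ / r) ^ ((p - q) / q) * ‖x‖ ^ (-p) * |u x| ^ p := by
      refine integrable_mul_abs_rpow hp0 hu1.continuous hu.hasCompactSupport fun x hx => ?_
      refine ContinuousAt.mul (Continuous.continuousAt ?_)
        (continuous_norm.continuousAt.rpow_const (Or.inl (norm_ne_zero_iff.2 (hne x hx))))
      exact Continuous.rpow_const (by fun_prop) fun _ => Or.inr (by positivity)
    have h1 : J ≤ ∫ x in Metric.ball c r,
        M * K * (logisticWeight δ t₀ L (Real.log ‖x‖) * ‖x‖ ^ (-p) * |u x| ^ p) := by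
      refine setIntegral_mono_on hint.integrableOn (hWint.const_mul _).integrableOn
        measurableSet_ball fun x hx => ?_
      by_cases hxu : x ∈ tsupport u
      · have h := ht₀ x hx (hne x hxu) (hΩ.norm_le_diam (hu.tsupport_subset hxu).1)
        rw [h2δ] at h
        calc min 1 (‖x‖ / r) ^ ((p - q) / q) * ‖x‖ ^ (-p) * |u x| ^ p
            ≤ M * K * logisticWeight δ t₀ L (Real.log ‖x‖) * ‖x‖ ^ (-p) * |u x| ^ p := by gcongr
          _ = _ := by ring
      · simp [image_eq_zero_of_notMem_tsupport hxu, Real.zero_rpow hp0.ne']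
    rw [integral_const_mul] at h1
    have h2 := setIntegral_le_integral (s := Metric.ball c r) hWint (.of_forall hWnn)
    have h3 : ∫ x, logisticWeight δ t₀ L (Real.log ‖x‖) * ‖x‖ ^ (-p) * |u x| ^ p ≤ I / a := by
      rw [le_div_iff₀ ha]; linarith
    calc J ≤ M * K * (I / a) := h1.trans (by gcongr; exact h2.trans h3)
      _ = _ := by ring
  have hHol := setIntegral_ball_rpow_le hn hq hqp hu1.continuous hu.hasCompactSupport
    (fun h => hne 0 h rfl) c hr
  rw [← hJ] at hHol
  have hB := volume_real_ball c hr
  set B := volume.real (Metric.ball c r) with hBdef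
  have hB0 : 0 < B := by rw [hB]; positivity
  have hA0 : 0 ≤ ∫ x in Metric.ball c r, |u x| ^ q / ‖x‖ ^ q :=
    integral_nonneg fun x => by positivity
  have hmean : (B⁻¹ * ∫ x in Metric.ball c r, |u x| ^ q / ‖x‖ ^ q) ^ (1 / q) ≤
      3 ^ ((p - q) / (p * q)) * B ^ (-(1 / p)) * J ^ (1 / p) := by
    calc (B⁻¹ * ∫ x in Metric.ball c r, |u x| ^ q / ‖x‖ ^ q) ^ (1 / q)
        ≤ (B⁻¹ * (J ^ (q / p) * (3 * B) ^ ((p - q) / p))) ^ (1 / q) := by gcongr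
      _ = 3 ^ ((p - q) / (p * q)) * B ^ (-(1 / p)) * J ^ (1 / p) := by
        rw [← Real.rpow_neg_one B, Real.mul_rpow (by norm_num) hB0.le,
          Real.mul_rpow (by positivity) (by positivity),
          Real.mul_rpow (by positivity) (by positivity),
          Real.mul_rpow (by positivity) (by positivity),
          ← Real.rpow_mul hB0.le, ← Real.rpow_mul hJ0, ← Real.rpow_mul (by norm_num),
          ← Real.rpow_mul hB0.le]
        have e1 : q / p * (1 / q) = 1 / p := by field_simp
        have e2 : (p - q) / p * (1 / q) = (p - q) / (p * q) := by field_simp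
        have e3 : B ^ (-(1 / p)) = B ^ (-1 * (1 / q)) * B ^ ((p - q) / (p * q)) := by
          rw [← Real.rpow_add hB0]; congr 1; field_simp; ring
        rw [e1, e2, e3]; ring
  have hX : logWeight (r / D) = K⁻¹ := rfl
  have hBp : B ^ (-(1 / p)) = r ^ (-((n : ℝ) / p)) * V ^ (-(1 / p)) := by
    rw [hB, Real.mul_rpow (by positivity) hV0.le, ← Real.rpow_natCast, ← Real.rpow_mul hr.le]
    congr 2; ring
  unfold localHardyMean
  rw [hX, ← hBdef]
  calc r ^ ((n : ℝ) / p) * K⁻¹ ^ (1 / p) *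
        (B⁻¹ * ∫ x in Metric.ball c r, |u x| ^ q / ‖x‖ ^ q) ^ (1 / q)
      ≤ r ^ ((n : ℝ) / p) * K⁻¹ ^ (1 / p) * (3 ^ ((p - q) / (p * q)) *
        (r ^ (-((n : ℝ) / p)) * V ^ (-(1 / p))) * (M / a * (K * I)) ^ (1 / p)) := by
        rw [← hBp]
        gcongr
        refine hmean.trans ?_
        gcongr
    _ = (M / a) ^ (1 / p) * 3 ^ ((p - q) / (p * q)) * V ^ (-(1 / p)) * I ^ (1 / p) := by
        rw [Real.mul_rpow (by positivity) (by positivity), Real.mul_rpow hK0.le hI,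
          Real.inv_rpow hK0.le, Real.rpow_neg hr.le]
        have h1 := Real.rpow_pos_of_pos hK0 (1 / p)
        have h2 := Real.rpow_pos_of_pos hr ((n : ℝ) / p)
        field_simp

theorem theoremC (n : ℕ) (hn : 2 ≤ n) (p q : ℝ) (hq : 1 ≤ q) (hqp : q < p) :
    ((n : ℝ) < p →
      ∃ Θ C : ℝ, 0 ≤ Θ ∧ 0 < C ∧
        ∀ Ω : Set (Euc n), IsBoundedDomainAtZero Ω →
        ∀ u : Euc n → ℝ, IsTestFunctionOn (Ω \ {0}) u →
          0 ≤ hardyDifference p Ω u ∧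
          ∀ (c : Euc n) (r D : ℝ), 0 < r → r < Metric.diam Ω →
            Real.exp Θ * Metric.diam Ω ≤ D →
            localHardyMean p q D u c r ≤ C * hardyDifference p Ω u ^ (1 / p)) ∧
    (p ≠ (n : ℝ) →
      ∃ Θ C : ℝ, 0 ≤ Θ ∧ 0 < C ∧
        ∀ Ω : Set (Euc n), IsBoundedDomainAtZero Ω →
        ∀ u : Euc n → ℝ, IsTestFunctionOn (Ω \ {0}) u →
          0 ≤ hardyDifference p Ω u ∧
          ∀ (c : Euc n) (r D : ℝ), 0 < r → r < Metric.diam Ω →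
            Real.exp Θ * Metric.diam Ω ≤ D →
            (0 : Euc n) ∈ Metric.closedBall c r →
            localHardyMean p q D u c r ≤ C * hardyDifference p Ω u ^ (1 / p)) := by
  have hp : 1 < p := by linarith
  refine ⟨fun hnp => ?_, fun hpn => ?_⟩
  · obtain ⟨C, hC, h⟩ := exists_localHardyMean_le hn hq hqp hnp.ne'
    exact ⟨0, C, le_rfl, hC, fun Ω hΩ u hu => ⟨hardyDifference_nonneg hp hΩ hu,
      fun c r D hr hrR hD => h Ω hΩ u hu c r D hr hrR (by simpa using hD)⟩⟩
  · obtain ⟨C, hC, h⟩ := exists_localHardyMean_le hn hq hqp hpn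
    exact ⟨0, C, le_rfl, hC, fun Ω hΩ u hu => ⟨hardyDifference_nonneg hp hΩ hu,
      fun c r D hr hrR hD _ => h Ω hΩ u hu c r D hr hrR (by simpa using hD)⟩⟩
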